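/- **Theorem (Existence and Characterization of Completion).** Let $X$ be a set. A *reproducing kernel* on a set $S$ is a function $K\colon S\times S\to\mathbb R$ with $K(x,y)=K(y,x)$ and $\sum_{i,j=1}^n\alpha_i\alpha_jK(x_i,x_j)\ge 0$ for all $n\ge 1$, $x_1,\dots,x_n\in S$, $\alpha_1,\dots,\alpha_n\in\mathbb R$; its Hilbert space $\mathcal H(K)$ is the closure of the linear span of the functions $k_x=K(x,\cdot)$, $x\in S$, under the inner product $\langle k_x,k_y\rangle=K(x,y)$. A *domain* on $X$ is a subset $\Omega\subset X\times X$ that contains the diagonal and satisfies $(x,y)\in\Omega\iff(y,x)\in\Omega$. A *completion* of a function $K_\Omega\colon\Omega\to\mathbb R$ is a reproducing kernel $K$ on $X$ with $K|_\Omega=K_\Omega$. For Hilbert spaces $\mathcal H_1,\mathcal H_2$, the projective norm on the algebraic tensor product $\mathcal H_1\otimes\mathcal H_2$ is $$\|\tau\|_\pi=\inf\Big\{\sum_{i=1}^n\|f_i\|\,\|g_i\| : n\ge 1,\ \tau=\sum_{i=1}^n f_i\otimes g_i,\ f_i\in\mathcal H_1,\ g_i\in\mathcal H_2\Big\},$$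 and $\mathcal H_1\hat\otimes_\pi\mathcal H_2$ is the completion of $\mathcal H_1\otimes\mathcal H_2$ under $\|\cdot\|_\pi$. Let $\Omega$ be a domain on $X$ and let $K_\Omega\colon\Omega\to\mathbb R$ be symmetric, i.e. $K_\Omega(x,y)=K_\Omega(y,x)$ for $(x,y)\in\Omega$. Assume that $X=X_1\sqcup X_2$ with $X_i\times X_i\subset\Omega$ and $K_{X_i}=K_\Omega|_{X_i\times X_i}$ a reproducing kernel on $X_i$ for $i=1,2$. Let $\Delta=\Omega\cap(X_1\times X_2)$ and, for $x\in X_i$, let $k_{x,X_i}=K_{X_i}(x,\cdot)\in\mathcal H(K_{X_i})$. 1. The following are equivalent: * $K_\Omega$ admits a completion; * the assignment $\Phi_0[k_{x,X_1}\otimes k_{y,X_2}]=K_\Omega(x,y)$ for $(x,y)\in\Delta$ defines a bounded linear functional $\Phi_0$ on $\operatorname{span}\{k_{x,X_1}\otimes k_{y,X_2}:(x,y)\in\Delta\}\subset\mathcal H(K_{X_1})\hat\otimes_\pi\mathcal H(K_{X_2})$ with $\|\Phi_0\|\le 1$; * for all $n\ge 1$, $(x_1,y_1),\dots,(x_n,y_n)\in\Delta$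 and $\alpha_1,\dots,\alpha_n\in\mathbb R$, $$\Big|\sum_{j=1}^n\alpha_jK_\Omega(x_j,y_j)\Big|\le\Big\|\sum_{j=1}^n\alpha_j\,k_{x_j,X_1}\otimes k_{y_j,X_2}\Big\|_\pi .$$ 2. The relation $$\Phi[k_{x,X_1}\otimes k_{y,X_2}]=K(x,y)\qquad(x\in X_1,\ y\in X_2)$$ is a bijective correspondence between the completions $K$ of $K_\Omega$ and the bounded linear extensions $\Phi$ of $\Phi_0$ to $\mathcal H(K_{X_1})\hat\otimes_\pi\mathcal H(K_{X_2})$ with $\|\Phi\|\le 1$. (If $\Phi_0$ is not a well-defined bounded functional, there are no such extensions and no completions.) -/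

import Mathlib

open scoped TensorProduct ComplexOrder

noncomputable section

/-! ### Reproducing kernels and their Hilbert spaces -/

/-- A real reproducing kernel on a set: a symmetric positive semidefinite function. -/
def IsReproducingKernel {α : Type*} (K : α → α → ℝ) : Prop :=
  (∀ x y, K x y = K y x) ∧
    ∀ (n : ℕ) (a : Fin n → ℝ) (x : Fin n → α),
      0 ≤ ∑ i, ∑ j, a i * a j * K (x i) (x j)

/-- A real kernel, seen as an operator-valued kernel: `K x y` acts on `ℝ` by multiplication. -/
def operatorKernel {α : Type*} (K : α → α → ℝ) : Matrix α α (ℝ →L[ℝ] ℝ) :=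
  Matrix.of fun x y => K x y • ContinuousLinearMap.id ℝ ℝ

theorem IsReproducingKernel.posSemidef {α : Type*} {K : α → α → ℝ}
    (hK : IsReproducingKernel K) : (operatorKernel K).PosSemidef := by
  have key := ((RKHS.posSemidef_tfae (K := operatorKernel K)).out 0 2)
  rw [key]
  refine ⟨?_, ?_⟩
  · ext x y
    have hid : ContinuousLinearMap.adjoint (ContinuousLinearMap.id ℝ ℝ) =
        ContinuousLinearMap.id ℝ ℝ := ContinuousLinearMap.adjoint_id
    simp [operatorKernel, Matrix.conjTranspose_apply, ContinuousLinearMap.star_eq_adjoint,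
      hK.1 y x, hid]
  · intro v
    have h := hK.2 v.support.card (fun i => v (v.support.equivFin.symm i))
      (fun i => (v.support.equivFin.symm i : α))
    have e1 : ∀ f : α → ℝ,
        ∑ i, f (v.support.equivFin.symm i : α) = ∑ x ∈ v.support, f x := by
      intro f
      rw [Equiv.sum_comp v.support.equivFin.symm (fun i => f (i : α))]
      exact Finset.sum_coe_sort v.support f
    have e2 : ∑ i, ∑ j, v (v.support.equivFin.symm i) * v (v.support.equivFin.symm j) *
          K (v.support.equivFin.symm i) (v.support.equivFin.symm j) =
        ∑ x ∈ v.support, ∑ y ∈ v.support, v x * v y * K x y := by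
      rw [← e1 fun x => ∑ y ∈ v.support, v x * v y * K x y]
      exact Finset.sum_congr rfl fun i _ =>
        e1 fun y => v (v.support.equivFin.symm i) * v y * K (v.support.equivFin.symm i) y
    refine (h.trans_eq e2).trans_eq ?_
    change _ = ∑ x ∈ v.support, ∑ y ∈ v.support,
      inner ℝ ((K y x • ContinuousLinearMap.id ℝ ℝ) (v x)) (v y)
    refine Finset.sum_congr rfl fun x _ => Finset.sum_congr rfl fun y _ => ?_
    simp [hK.1 y x]
    ring

/-- The reproducing kernel Hilbert space `H(K)` of a real reproducing kernel `K`. -/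
def KernelSpace {α : Type*} {K : α → α → ℝ} (hK : IsReproducingKernel K) : Type _ :=
  haveI : Fact (operatorKernel K).PosSemidef := ⟨hK.posSemidef⟩
  RKHS.OfKernel (operatorKernel K)

namespace KernelSpace

variable {α : Type*} {K : α → α → ℝ} (hK : IsReproducingKernel K)

instance instNormedAddCommGroup : NormedAddCommGroup (KernelSpace hK) :=
  haveI : Fact (operatorKernel K).PosSemidef := ⟨hK.posSemidef⟩
  inferInstanceAs (NormedAddCommGroup (RKHS.OfKernel (operatorKernel K)))

instance instInnerProductSpace : InnerProductSpace ℝ (KernelSpace hK) :=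
  haveI : Fact (operatorKernel K).PosSemidef := ⟨hK.posSemidef⟩
  inferInstanceAs (InnerProductSpace ℝ (RKHS.OfKernel (operatorKernel K)))

instance instCompleteSpace : CompleteSpace (KernelSpace hK) :=
  haveI : Fact (operatorKernel K).PosSemidef := ⟨hK.posSemidef⟩
  inferInstanceAs (CompleteSpace (RKHS.OfKernel (operatorKernel K)))

instance instRKHS : RKHS ℝ (KernelSpace hK) α ℝ :=
  haveI : Fact (operatorKernel K).PosSemidef := ⟨hK.posSemidef⟩
  inferInstanceAs (RKHS ℝ (RKHS.OfKernel (operatorKernel K)) α ℝ)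

theorem kernel_eq : RKHS.kernel (KernelSpace hK) = operatorKernel K :=
  haveI : Fact (operatorKernel K).PosSemidef := ⟨hK.posSemidef⟩
  RKHS.OfKernel.kernel_ofKernel (K := operatorKernel K)

/-- The generator `k_x` of `H(K)`. -/
def generator (x : α) : KernelSpace hK := RKHS.kerFun (KernelSpace hK) x (1 : ℝ)

/-- As a function, the generator `k_x` is `y ↦ K x y`. -/
theorem generator_apply (x y : α) : generator hK x y = K x y := by
  rw [generator, RKHS.kerFun_apply, kernel_eq]
  simp [operatorKernel, hK.1 y x]

/-- The reproducing property. -/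
theorem inner_generator (f : KernelSpace hK) (x : α) :
    inner ℝ f (generator hK x) = f x := by
  rw [generator, RKHS.inner_kerFun]
  simp

theorem inner_generator_generator (x y : α) :
    inner ℝ (generator hK x) (generator hK y) = K x y := by
  rw [inner_generator, generator_apply]

/-- The generators span a dense subspace. -/
theorem closure_span_generator :
    (Submodule.span ℝ (Set.range (generator hK))).topologicalClosure = ⊤ := by
  have h := RKHS.kerFun_dense (KernelSpace hK)
  rw [eq_top_iff, ← h]
  refine Submodule.topologicalClosure_mono (Submodule.span_le.mpr ?_)
  rintro _ ⟨x, v, rfl⟩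
  have : RKHS.kerFun (KernelSpace hK) x v = v • generator hK x := by
    rw [generator, ← map_smul, smul_eq_mul, mul_one]
  rw [this]
  exact Submodule.smul_mem _ _ (Submodule.subset_span ⟨x, rfl⟩)

end KernelSpace

/-! ### The projective tensor product -/

section Projective

variable {E F : Type*} [NormedAddCommGroup E] [NormedSpace ℝ E]
  [NormedAddCommGroup F] [NormedSpace ℝ F]

/-- The costs `∑ ‖f i‖ ‖g i‖` of the finite representations `τ = ∑ f i ⊗ g i`. -/
def projCosts (τ : E ⊗[ℝ] F) : Set ℝ :=
  {r | ∃ (n : ℕ) (f : Fin n → E) (g : Fin n → F),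
    τ = ∑ i, f i ⊗ₜ[ℝ] g i ∧ r = ∑ i, ‖f i‖ * ‖g i‖}

/-- The projective tensor norm. -/
def projNorm (τ : E ⊗[ℝ] F) : ℝ := sInf (projCosts τ)

theorem projCosts_nonneg (τ : E ⊗[ℝ] F) : ∀ r ∈ projCosts τ, 0 ≤ r := by
  rintro r ⟨n, f, g, -, rfl⟩
  positivity

theorem projCosts_bddBelow (τ : E ⊗[ℝ] F) : BddBelow (projCosts τ) :=
  ⟨0, projCosts_nonneg τ⟩

theorem projCosts_add {σ τ : E ⊗[ℝ] F} {r s : ℝ} (hr : r ∈ projCosts σ)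
    (hs : s ∈ projCosts τ) : r + s ∈ projCosts (σ + τ) := by
  obtain ⟨m, f, g, rfl, rfl⟩ := hr
  obtain ⟨n, f', g', rfl, rfl⟩ := hs
  exact ⟨m + n, Fin.append f f', Fin.append g g', by simp [Fin.sum_univ_add],
    by simp [Fin.sum_univ_add]⟩

theorem projCosts_smul {τ : E ⊗[ℝ] F} {r : ℝ} (c : ℝ) (hr : r ∈ projCosts τ) :
    ‖c‖ * r ∈ projCosts (c • τ) := by
  obtain ⟨n, f, g, rfl, rfl⟩ := hr
  exact ⟨n, fun i => c • f i, g, by simp [Finset.smul_sum, TensorProduct.smul_tmul'],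
    by simp [Finset.mul_sum, norm_smul, mul_assoc]⟩

theorem projCosts_nonempty (τ : E ⊗[ℝ] F) : (projCosts τ).Nonempty := by
  induction τ with
  | zero => exact ⟨0, 0, Fin.elim0, Fin.elim0, by simp, by simp⟩
  | tmul x y => exact ⟨‖x‖ * ‖y‖, 1, fun _ => x, fun _ => y, by simp, by simp⟩
  | add σ τ hσ hτ =>
    obtain ⟨r, hr⟩ := hσ
    obtain ⟨s, hs⟩ := hτ
    exact ⟨r + s, projCosts_add hr hs⟩

theorem projNorm_zero : projNorm (0 : E ⊗[ℝ] F) = 0 :=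
  le_antisymm
    (csInf_le (projCosts_bddBelow _) ⟨0, Fin.elim0, Fin.elim0, by simp, by simp⟩)
    (Real.sInf_nonneg (projCosts_nonneg _))

theorem projNorm_add_le (σ τ : E ⊗[ℝ] F) :
    projNorm (σ + τ) ≤ projNorm σ + projNorm τ := by
  refine le_of_forall_pos_le_add fun ε hε => ?_
  obtain ⟨r, hr, hr'⟩ := Real.lt_sInf_add_pos (projCosts_nonempty σ) (half_pos hε)
  obtain ⟨s, hs, hs'⟩ := Real.lt_sInf_add_pos (projCosts_nonempty τ) (half_pos hε)
  have h := csInf_le (projCosts_bddBelow (σ + τ)) (projCosts_add hr hs)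
  simp only [projNorm]
  linarith

theorem projNorm_smul_le (c : ℝ) (τ : E ⊗[ℝ] F) :
    projNorm (c • τ) ≤ ‖c‖ * projNorm τ := by
  rw [projNorm, projNorm, ← smul_eq_mul, ← Real.sInf_smul_of_nonneg (norm_nonneg c)]
  refine le_csInf ((projCosts_nonempty τ).smul_set) ?_
  rintro _ ⟨r, hr, rfl⟩
  exact csInf_le (projCosts_bddBelow _) (projCosts_smul c hr)

end Projective

/-- The algebraic tensor product, to be normed by the projective tensor norm. -/
def ProjTensor (E F : Type*) [NormedAddCommGroup E] [NormedSpace ℝ E]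
    [NormedAddCommGroup F] [NormedSpace ℝ F] : Type _ := E ⊗[ℝ] F

namespace ProjTensor

variable (E F : Type*) [NormedAddCommGroup E] [NormedSpace ℝ E]
  [NormedAddCommGroup F] [NormedSpace ℝ F]

instance instAddCommGroup : AddCommGroup (ProjTensor E F) :=
  inferInstanceAs (AddCommGroup (E ⊗[ℝ] F))

instance instModule : Module ℝ (ProjTensor E F) :=
  inferInstanceAs (Module ℝ (E ⊗[ℝ] F))

/-- The projective tensor norm, bundled as a seminorm. -/
def seminorm : Seminorm ℝ (ProjTensor E F) :=
  Seminorm.ofSMulLE (fun τ : ProjTensor E F => projNorm (E := E) (F := F) τ)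
    projNorm_zero projNorm_add_le projNorm_smul_le

instance instSeminormedAddCommGroup : SeminormedAddCommGroup (ProjTensor E F) :=
  (seminorm E F).toAddGroupSeminorm.toSeminormedAddCommGroup

instance instNormedSpace : NormedSpace ℝ (ProjTensor E F) := ⟨projNorm_smul_le⟩

variable {E F}

/-- The elementary tensor `f ⊗ g`. -/
def tmul (f : E) (g : F) : ProjTensor E F := f ⊗ₜ[ℝ] g

theorem norm_eq (τ : E ⊗[ℝ] F) : ‖(show ProjTensor E F from τ)‖ = projNorm τ := rfl

end ProjTensor

/-- The projective tensor product space: the completion of the algebraic tensor product under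
the projective tensor norm. -/
abbrev ProjTensorSpace (E F : Type*) [NormedAddCommGroup E] [NormedSpace ℝ E]
    [NormedAddCommGroup F] [NormedSpace ℝ F] : Type _ :=
  UniformSpace.Completion (ProjTensor E F)

/-- The elementary tensor `f ⊗ g` in the projective tensor product space. -/
def projTmul {E F : Type*} [NormedAddCommGroup E] [NormedSpace ℝ E]
    [NormedAddCommGroup F] [NormedSpace ℝ F] (f : E) (g : F) : ProjTensorSpace E F :=
  ((ProjTensor.tmul f g : ProjTensor E F) : UniformSpace.Completion (ProjTensor E F))

/-! ### Domains and completions -/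

section Domains

variable {X : Type*}

/-- A domain on `X`: a symmetric subset of `X × X` which contains the diagonal. -/
structure IsKernelDomain (Ω : Set (X × X)) : Prop where
  symm : ∀ {x y : X}, (x, y) ∈ Ω → (y, x) ∈ Ω
  diag : ∀ x : X, (x, x) ∈ Ω

/-- The restriction of `KΩ` to a square `A × A ⊆ Ω`. -/
def squareRestrict {Ω : Set (X × X)} (KΩ : Ω → ℝ) {A : Set X} (hA : A ×ˢ A ⊆ Ω) :
    A → A → ℝ :=
  fun x y => KΩ ⟨(x, y), hA ⟨x.2, y.2⟩⟩

/-- `K` is a completion of `KΩ`: a reproducing kernel on `X` which restricts to `KΩ` on `Ω`. -/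
def IsKernelCompletion {Ω : Set (X × X)} (KΩ : Ω → ℝ) (K : X → X → ℝ) : Prop :=
  IsReproducingKernel K ∧ ∀ p : Ω, K p.1.1 p.1.2 = KΩ p

section TwoSquares

variable {Ω : Set (X × X)} {KΩ : Ω → ℝ} {X₁ X₂ : Set X}
  {hX₁ : X₁ ×ˢ X₁ ⊆ Ω} {hX₂ : X₂ ×ˢ X₂ ⊆ Ω}
  (hK₁ : IsReproducingKernel (squareRestrict KΩ hX₁))
  (hK₂ : IsReproducingKernel (squareRestrict KΩ hX₂))

/-- The tensor `k_{x,X₁} ⊗ k_{y,X₂}` in the projective tensor product of `H(K_{X₁})` and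
`H(K_{X₂})`. -/
def generatorTensor (x : X₁) (y : X₂) :
    ProjTensorSpace (KernelSpace hK₁) (KernelSpace hK₂) :=
  projTmul (KernelSpace.generator hK₁ x) (KernelSpace.generator hK₂ y)

/-- The span of the tensors `k_{x,X₁} ⊗ k_{y,X₂}` with `(x, y) ∈ Δ = Ω ∩ (X₁ × X₂)`. -/
def deltaSpan : Submodule ℝ (ProjTensorSpace (KernelSpace hK₁) (KernelSpace hK₂)) :=
  Submodule.span ℝ
    {τ | ∃ (x : X₁) (y : X₂), ((x : X), (y : X)) ∈ Ω ∧ generatorTensor hK₁ hK₂ x y = τ}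

theorem generatorTensor_mem_deltaSpan {x : X₁} {y : X₂} (h : ((x : X), (y : X)) ∈ Ω) :
    generatorTensor hK₁ hK₂ x y ∈ deltaSpan hK₁ hK₂ :=
  Submodule.subset_span ⟨x, y, h, rfl⟩

/-- `Φ₀` is the bounded linear functional with `Φ₀[k_{x,X₁} ⊗ k_{y,X₂}] = KΩ(x, y)` on `Δ`. -/
def IsDeltaFunctional (Φ₀ : deltaSpan hK₁ hK₂ →L[ℝ] ℝ) : Prop :=
  ∀ (x : X₁) (y : X₂) (h : ((x : X), (y : X)) ∈ Ω),
    Φ₀ ⟨generatorTensor hK₁ hK₂ x y, generatorTensor_mem_deltaSpan hK₁ hK₂ h⟩ =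
      KΩ ⟨((x : X), (y : X)), h⟩

/-- `Φ` is a bounded extension of `Φ₀` to the projective tensor product with `‖Φ‖ ≤ 1`. -/
def IsContractiveExtension
    (Φ : ProjTensorSpace (KernelSpace hK₁) (KernelSpace hK₂) →L[ℝ] ℝ) : Prop :=
  ‖Φ‖ ≤ 1 ∧ ∃ Φ₀ : deltaSpan hK₁ hK₂ →L[ℝ] ℝ, IsDeltaFunctional hK₁ hK₂ Φ₀ ∧
    ∀ τ : deltaSpan hK₁ hK₂, Φ τ = Φ₀ τ

end TwoSquares

end Domains

end

/-! A completion `K` is determined by its block on `X₁ × X₂`: the diagonal blocks are prescribed and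
the fourth block follows by symmetry. In `H(K)` this block is an inner product `⟨V₁ f, V₂ g⟩`, where
the contraction `Vᵢ` sends each generator of `H(K_{Xᵢ})` to the generator of `H(K)` at the same
point. It thus comes from a bilinear form `b` with `|b f g| ≤ ‖f‖ ‖g‖`. Conversely, such a form
gives a positive kernel, since `‖s‖² + ‖t‖² + 2 b(s, t) ≥ (‖s‖ - ‖t‖)² ≥ 0`
(`isReproducingKernel_of_cross_contraction`).

These forms are exactly the functionals of norm at most one on the projective tensor product
(`exists_projTensorSpace_functional`, `projBilin`), whence the bijection. For existence, Hahn–Banach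
extends `Φ₀` without increasing its norm, and the inequality on finite sums says that `Φ₀` is well
defined and contractive on its span. -/

/-! ### Contractions defined on generators -/

/-- A family `u` that is norm-dominated by a family `v` with dense span is the image of `v` under
a contraction. -/
theorem exists_contraction_of_linearCombination_norm_le {ι E F : Type*}
    [NormedAddCommGroup E] [NormedSpace ℝ E] [NormedAddCommGroup F] [NormedSpace ℝ F]
    [CompleteSpace F] (v : ι → E) (u : ι → F)
    (hv : (Submodule.span ℝ (Set.range v)).topologicalClosure = ⊤)
    (h : ∀ c : ι →₀ ℝ, ‖Finsupp.linearCombination ℝ u c‖ ≤ ‖Finsupp.linearCombination ℝ v c‖) :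
    ∃ L : E →L[ℝ] F, ‖L‖ ≤ 1 ∧ ∀ i, L (v i) = u i := by
  have hd : DenseRange (Finsupp.linearCombination ℝ v) := by
    rw [← Submodule.dense_iff_topologicalClosure_eq_top, ← Finsupp.range_linearCombination] at hv
    exact hv
  have h' : ∀ c, ‖Finsupp.linearCombination ℝ u c‖ ≤ 1 * ‖Finsupp.linearCombination ℝ v c‖ := by
    simpa using h
  -- The bound makes `∑ cᵢ vᵢ ↦ ∑ cᵢ uᵢ` well defined even when the `vᵢ` are linearly dependent;
  -- density extends it to `E`.
  refine ⟨(Finsupp.linearCombination ℝ u).extendOfNorm (Finsupp.linearCombination ℝ v),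
    LinearMap.opNorm_extendOfNorm_le hd zero_le_one h', fun i => ?_⟩
  have := LinearMap.extendOfNorm_eq hd ⟨1, h'⟩ (Finsupp.single i 1)
  simpa using this

theorem norm_linearCombination_eq_of_inner_eq {ι E F : Type*}
    [NormedAddCommGroup E] [InnerProductSpace ℝ E] [NormedAddCommGroup F] [InnerProductSpace ℝ F]
    (v : ι → E) (u : ι → F) (h : ∀ i j, inner ℝ (u i) (u j) = inner ℝ (v i) (v j))
    (c : ι →₀ ℝ) :
    ‖Finsupp.linearCombination ℝ u c‖ = ‖Finsupp.linearCombination ℝ v c‖ := by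
  rw [← sq_eq_sq₀ (norm_nonneg _) (norm_nonneg _), ← real_inner_self_eq_norm_sq,
    ← real_inner_self_eq_norm_sq]
  simp only [Finsupp.linearCombination_apply, Finsupp.sum, sum_inner, inner_sum, inner_smul_left,
    inner_smul_right, h]

/-- A family of vectors whose Gram matrix is `K` is the image of the generators of `H(K)` under a
contraction. -/
theorem KernelSpace.exists_contraction {α F : Type*} {K : α → α → ℝ}
    (hK : IsReproducingKernel K) [NormedAddCommGroup F] [InnerProductSpace ℝ F] [CompleteSpace F]
    (u : α → F) (hu : ∀ x y, inner ℝ (u x) (u y) = K x y) :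
    ∃ V : KernelSpace hK →L[ℝ] F, ‖V‖ ≤ 1 ∧ ∀ x, V (generator hK x) = u x :=
  exists_contraction_of_linearCombination_norm_le _ u (closure_span_generator hK) fun c =>
    (norm_linearCombination_eq_of_inner_eq _ u
      (fun x y => by rw [hu, inner_generator_generator]) c).le

theorem KernelSpace.continuousLinearMap_ext {α F : Type*} {K : α → α → ℝ}
    (hK : IsReproducingKernel K) [NormedAddCommGroup F] [NormedSpace ℝ F]
    {f g : KernelSpace hK →L[ℝ] F} (h : ∀ x, f (generator hK x) = g (generator hK x)) : f = g :=
  ContinuousLinearMap.ext_on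
    (Submodule.dense_iff_topologicalClosure_eq_top.mpr (closure_span_generator hK))
    (by rintro _ ⟨x, rfl⟩; exact h x)

/-! ### Contractive bilinear forms and functionals on the projective tensor product -/

section Projective

variable {E F : Type*} [NormedAddCommGroup E] [NormedSpace ℝ E]
  [NormedAddCommGroup F] [NormedSpace ℝ F]

/-- Each representation of `τ` bounds the value by its own cost; the infimum over representations
gives the norm. -/
theorem abs_lift_le_projNorm (b : E →ₗ[ℝ] F →ₗ[ℝ] ℝ) (hb : ∀ f g, |b f g| ≤ ‖f‖ * ‖g‖)
    (τ : E ⊗[ℝ] F) : |TensorProduct.lift b τ| ≤ projNorm τ := by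
  refine le_csInf (projCosts_nonempty τ) ?_
  rintro _ ⟨n, f, g, rfl, rfl⟩
  rw [map_sum]
  refine (Finset.abs_sum_le_sum_abs _ _).trans (Finset.sum_le_sum fun i _ => ?_)
  simpa using hb (f i) (g i)

/-- A contractive bilinear form is represented by a contractive functional on the projective
tensor product. -/
theorem exists_projTensorSpace_functional (b : E →ₗ[ℝ] F →ₗ[ℝ] ℝ)
    (hb : ∀ f g, |b f g| ≤ ‖f‖ * ‖g‖) :
    ∃ Φ : ProjTensorSpace E F →L[ℝ] ℝ, ‖Φ‖ ≤ 1 ∧ ∀ f g, Φ (projTmul f g) = b f g := by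
  let ℓ : ProjTensor E F →ₗ[ℝ] ℝ := TensorProduct.lift b
  let e : ProjTensor E F →ₗ[ℝ] ProjTensorSpace E F :=
    (UniformSpace.Completion.toComplL (𝕜 := ℝ) (E := ProjTensor E F)).toLinearMap
  have hd : DenseRange e := UniformSpace.Completion.denseRange_coe
  -- The projective norm enters only as a seminorm, so injectivity of `e` is not available; this
  -- bound lets `ℓ` factor through `e` regardless.
  have h : ∀ τ, ‖ℓ τ‖ ≤ 1 * ‖e τ‖ := fun τ => by
    rw [one_mul]
    exact (abs_lift_le_projNorm b hb τ).trans_eq (UniformSpace.Completion.norm_coe τ).symm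
  refine ⟨ℓ.extendOfNorm e, LinearMap.opNorm_extendOfNorm_le hd zero_le_one h, fun f g => ?_⟩
  exact (LinearMap.extendOfNorm_eq hd ⟨1, h⟩ (ProjTensor.tmul f g)).trans
    (TensorProduct.lift.tmul f g)

theorem norm_projTmul_le (f : E) (g : F) : ‖projTmul f g‖ ≤ ‖f‖ * ‖g‖ := by
  rw [projTmul, UniformSpace.Completion.norm_coe]
  exact csInf_le (projCosts_bddBelow _) ⟨1, fun _ => f, fun _ => g, by simp [ProjTensor.tmul],
    by simp⟩

/-- The bounded bilinear form `(f, g) ↦ Φ (f ⊗ g)`. -/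
noncomputable def projBilin (Φ : ProjTensorSpace E F →L[ℝ] ℝ) : E →L[ℝ] F →L[ℝ] ℝ :=
  LinearMap.mkContinuous₂
    ((TensorProduct.mk ℝ E F).compr₂ (Φ.toLinearMap.comp
      (UniformSpace.Completion.toComplL (𝕜 := ℝ) (E := ProjTensor E F)).toLinearMap)) ‖Φ‖
    fun f g => (Φ.le_opNorm (projTmul f g)).trans (by
      rw [mul_assoc]; exact mul_le_mul_of_nonneg_left (norm_projTmul_le f g) (norm_nonneg _))

theorem projBilin_apply (Φ : ProjTensorSpace E F →L[ℝ] ℝ) (f : E) (g : F) :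
    projBilin Φ f g = Φ (projTmul f g) := rfl

theorem abs_projBilin_le {Φ : ProjTensorSpace E F →L[ℝ] ℝ} (hΦ : ‖Φ‖ ≤ 1) (f : E) (g : F) :
    |projBilin Φ f g| ≤ ‖f‖ * ‖g‖ :=
  (Φ.le_of_opNorm_le hΦ (projTmul f g)).trans (by
    rw [one_mul]; exact norm_projTmul_le f g)

/-- Elementary tensors generate the algebraic tensor product additively, and its image is dense in
the completion. -/
theorem projBilin_injective :
    Function.Injective (projBilin : (ProjTensorSpace E F →L[ℝ] ℝ) → E →L[ℝ] F →L[ℝ] ℝ) := by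
  intro Φ Ψ h
  have h' : ∀ τ : E ⊗[ℝ] F, Φ ((show ProjTensor E F from τ : ProjTensor E F) :
      UniformSpace.Completion (ProjTensor E F)) = Ψ ((show ProjTensor E F from τ : ProjTensor E F) :
      UniformSpace.Completion (ProjTensor E F)) := by
    intro τ
    induction τ with
    | zero => exact (map_zero Φ).trans (map_zero Ψ).symm
    | tmul f g => exact congrArg (fun b => b f g) h
    | add σ τ hσ hτ =>
      have hadd (Θ : ProjTensorSpace E F →L[ℝ] ℝ) (σ τ : ProjTensor E F) :
          Θ ((σ + τ : ProjTensor E F) : UniformSpace.Completion (ProjTensor E F)) =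
            Θ σ + Θ τ := by rw [UniformSpace.Completion.coe_add, map_add]
      exact (hadd Φ σ τ).trans ((congrArg₂ (· + ·) hσ hτ).trans (hadd Ψ σ τ).symm)
  refine ContinuousLinearMap.ext fun τ => ?_
  induction τ using UniformSpace.Completion.induction_on with
  | hp => exact isClosed_eq Φ.continuous Ψ.continuous
  | ih τ => exact h' τ

end Projective

/-! ### Positivity from a contractive cross term -/

theorem inner_sum_smul_sum_smul {ι E : Type*} [Fintype ι] [NormedAddCommGroup E]
    [InnerProductSpace ℝ E] (a : ι → ℝ) (v : ι → E) :
    inner ℝ (∑ i, a i • v i) (∑ i, a i • v i) = ∑ i, ∑ j, a i * a j * inner ℝ (v i) (v j) := by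
  rw [sum_inner]
  refine Finset.sum_congr rfl fun i _ => ?_
  rw [inner_sum]
  refine Finset.sum_congr rfl fun j _ => ?_
  rw [real_inner_smul_left, real_inner_smul_right, mul_assoc]

/-- The kernel with feature maps `c₁`, `c₂` and a contractive cross term `b` is reproducing. -/
theorem isReproducingKernel_of_cross_contraction {X E F : Type*}
    [NormedAddCommGroup E] [InnerProductSpace ℝ E] [NormedAddCommGroup F] [InnerProductSpace ℝ F]
    (b : E →L[ℝ] F →L[ℝ] ℝ) (hb : ∀ f g, |b f g| ≤ ‖f‖ * ‖g‖) (c₁ : X → E) (c₂ : X → F) :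
    IsReproducingKernel fun u v =>
      inner ℝ (c₁ u) (c₁ v) + inner ℝ (c₂ u) (c₂ v) + b (c₁ u) (c₂ v) + b (c₁ v) (c₂ u) := by
  refine ⟨fun u v => by
    simp only [real_inner_comm (c₁ u), real_inner_comm (c₂ u)]; ring, fun n a x => ?_⟩
  set s : E := ∑ i, a i • c₁ (x i) with hs
  set t : F := ∑ i, a i • c₂ (x i) with ht
  have key : ∑ i, ∑ j, a i * a j * (inner ℝ (c₁ (x i)) (c₁ (x j)) + inner ℝ (c₂ (x i)) (c₂ (x j))
      + b (c₁ (x i)) (c₂ (x j)) + b (c₁ (x j)) (c₂ (x i)))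
      = inner ℝ s s + inner ℝ t t + b s t + b s t := by
    have e1 : inner ℝ s s = ∑ i, ∑ j, a i * a j * inner ℝ (c₁ (x i)) (c₁ (x j)) := by
      rw [hs, inner_sum_smul_sum_smul]
    have e2 : inner ℝ t t = ∑ i, ∑ j, a i * a j * inner ℝ (c₂ (x i)) (c₂ (x j)) := by
      rw [ht, inner_sum_smul_sum_smul]
    have e3 : b s t = ∑ i, ∑ j, a i * a j * b (c₁ (x i)) (c₂ (x j)) := by
      rw [hs, map_sum b, sum_apply]
      refine Finset.sum_congr rfl fun i _ => ?_
      rw [ht, map_sum]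
      refine Finset.sum_congr rfl fun j _ => ?_
      simp only [map_smul, smul_apply, smul_eq_mul]
      ring
    -- The same value with the summation indices exchanged matches the transposed cross term.
    have e4 : b s t = ∑ i, ∑ j, a i * a j * b (c₁ (x j)) (c₂ (x i)) := by
      rw [e3, Finset.sum_comm]
      simp only [mul_comm (a _) (a _)]
    nth_rw 2 [e4]
    rw [e1, e2, e3]
    simp only [mul_add, Finset.sum_add_distrib]
  change 0 ≤ ∑ i, ∑ j, _
  rw [key, real_inner_self_eq_norm_sq, real_inner_self_eq_norm_sq]
  -- The lower bound `b s t ≥ -‖s‖ ‖t‖` leaves at least `(‖s‖ - ‖t‖)²`.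
  have := (abs_le.mp (hb s t)).1
  nlinarith [sq_nonneg (‖s‖ - ‖t‖)]

/-! ### Completions versus contractive extensions -/

section TwoSquares

variable {X : Type*} {Ω : Set (X × X)} {KΩ : Ω → ℝ} {X₁ X₂ : Set X}
  {hX₁ : X₁ ×ˢ X₁ ⊆ Ω} {hX₂ : X₂ ×ˢ X₂ ⊆ Ω}
  (hK₁ : IsReproducingKernel (squareRestrict KΩ hX₁))
  (hK₂ : IsReproducingKernel (squareRestrict KΩ hX₂))

/-- The associated bilinear form is continuous in each variable, and generators span a dense
subspace of each factor. -/
theorem projTensorSpace_functional_ext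
    {Φ Ψ : ProjTensorSpace (KernelSpace hK₁) (KernelSpace hK₂) →L[ℝ] ℝ}
    (h : ∀ x y, Φ (generatorTensor hK₁ hK₂ x y) = Ψ (generatorTensor hK₁ hK₂ x y)) : Φ = Ψ :=
  projBilin_injective <| KernelSpace.continuousLinearMap_ext hK₁ fun x =>
    KernelSpace.continuousLinearMap_ext hK₂ fun y => h x y

/-- `Φ₀` can only be the restriction of `Φ`, so its existence reduces to prescribed values on
generator tensors. -/
theorem isContractiveExtension_iff
    {Φ : ProjTensorSpace (KernelSpace hK₁) (KernelSpace hK₂) →L[ℝ] ℝ} :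
    IsContractiveExtension hK₁ hK₂ Φ ↔ ‖Φ‖ ≤ 1 ∧
      ∀ (x : X₁) (y : X₂) (h : ((x : X), (y : X)) ∈ Ω),
        Φ (generatorTensor hK₁ hK₂ x y) = KΩ ⟨((x : X), (y : X)), h⟩ := by
  refine and_congr_right fun _ => ⟨?_, fun h => ?_⟩
  · rintro ⟨Φ₀, hΦ₀, hΦ⟩ x y h
    rw [← hΦ₀ x y h, ← hΦ]
  · exact ⟨Φ.comp (deltaSpan hK₁ hK₂).subtypeL, fun x y hxy => h x y hxy, fun _ => rfl⟩

theorem IsKernelCompletion.exists_isContractiveExtension {K : X → X → ℝ}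
    (hK : IsKernelCompletion KΩ K) :
    ∃ Φ, IsContractiveExtension hK₁ hK₂ Φ ∧
      ∀ x y, Φ (generatorTensor hK₁ hK₂ x y) = K x y := by
  obtain ⟨V₁, hV₁, h₁⟩ := KernelSpace.exists_contraction hK₁
    (fun x => KernelSpace.generator hK.1 (x : X)) fun x y => by
      rw [KernelSpace.inner_generator_generator]
      exact hK.2 ⟨((x : X), (y : X)), hX₁ ⟨x.2, y.2⟩⟩
  obtain ⟨V₂, hV₂, h₂⟩ := KernelSpace.exists_contraction hK₂
    (fun x => KernelSpace.generator hK.1 (x : X)) fun x y => by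
      rw [KernelSpace.inner_generator_generator]
      exact hK.2 ⟨((x : X), (y : X)), hX₂ ⟨x.2, y.2⟩⟩
  obtain ⟨Φ, hΦ, h⟩ := exists_projTensorSpace_functional
    ((innerₗ (KernelSpace hK.1)).compl₁₂ V₁.toLinearMap V₂.toLinearMap)
    fun f g => by
      refine (abs_real_inner_le_norm (V₁ f) (V₂ g)).trans ?_
      have hf := V₁.le_of_opNorm_le hV₁ f
      have hg := V₂.le_of_opNorm_le hV₂ g
      rw [one_mul] at hf hg
      exact mul_le_mul hf hg (norm_nonneg _) (norm_nonneg _)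
  have hΦK : ∀ x y, Φ (generatorTensor hK₁ hK₂ x y) = K x y := fun x y => by
    rw [generatorTensor, h]
    simp [h₁, h₂, KernelSpace.inner_generator_generator]
  refine ⟨Φ, (isContractiveExtension_iff hK₁ hK₂).2 ⟨hΦ, fun x y hxy => ?_⟩, hΦK⟩
  rw [hΦK]
  exact hK.2 ⟨_, hxy⟩

theorem IsContractiveExtension.exists_isKernelCompletion (hΩ : IsKernelDomain Ω)
    (hsymm : ∀ (x y : X) (h : (x, y) ∈ Ω), KΩ ⟨(x, y), h⟩ = KΩ ⟨(y, x), hΩ.symm h⟩)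
    (hcover : X₁ ∪ X₂ = Set.univ) (hdisj : Disjoint X₁ X₂)
    {Φ : ProjTensorSpace (KernelSpace hK₁) (KernelSpace hK₂) →L[ℝ] ℝ}
    (hΦ : IsContractiveExtension hK₁ hK₂ Φ) :
    ∃ K, IsKernelCompletion KΩ K ∧
      ∀ (x : X₁) (y : X₂), Φ (generatorTensor hK₁ hK₂ x y) = K x y := by
  classical
  rw [isContractiveExtension_iff] at hΦ
  -- With generators extended by zero, exactly one of the four terms of the kernel can survive on
  -- each block of `X × X`.
  let c₁ : X → KernelSpace hK₁ := fun u =>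
    if h : u ∈ X₁ then KernelSpace.generator hK₁ ⟨u, h⟩ else 0
  let c₂ : X → KernelSpace hK₂ := fun u =>
    if h : u ∈ X₂ then KernelSpace.generator hK₂ ⟨u, h⟩ else 0
  have h11 : ∀ u (h : u ∈ X₁), c₁ u = KernelSpace.generator hK₁ ⟨u, h⟩ := fun u h => dif_pos h
  have h22 : ∀ u (h : u ∈ X₂), c₂ u = KernelSpace.generator hK₂ ⟨u, h⟩ := fun u h => dif_pos h
  have h12 : ∀ u, u ∈ X₂ → c₁ u = 0 := fun u h => dif_neg (hdisj.notMem_of_mem_right h)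
  have h21 : ∀ u, u ∈ X₁ → c₂ u = 0 := fun u h => dif_neg (hdisj.notMem_of_mem_left h)
  have hrep := isReproducingKernel_of_cross_contraction (projBilin Φ) (abs_projBilin_le hΦ.1) c₁ c₂
  refine ⟨_, ⟨hrep, ?_⟩, fun x y => ?_⟩
  · rintro ⟨⟨u, v⟩, huv⟩
    have hu : u ∈ X₁ ∪ X₂ := hcover ▸ Set.mem_univ u
    have hv : v ∈ X₁ ∪ X₂ := hcover ▸ Set.mem_univ v
    rcases hu with hu | hu <;> rcases hv with hv | hv
    · simp [h11 u hu, h11 v hv, h21 u hu, h21 v hv, KernelSpace.inner_generator_generator,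
        squareRestrict]
    · simpa [h11 u hu, h12 v hv, h21 u hu, h22 v hv, projBilin_apply, generatorTensor] using
        hΦ.2 ⟨u, hu⟩ ⟨v, hv⟩ huv
    · rw [hsymm]
      simpa [h12 u hu, h11 v hv, h22 u hu, h21 v hv, projBilin_apply, generatorTensor] using
        hΦ.2 ⟨v, hv⟩ ⟨u, hu⟩ (hΩ.symm huv)
    · simp [h12 u hu, h12 v hv, h22 u hu, h22 v hv, KernelSpace.inner_generator_generator,
        squareRestrict]
  · simp [h11 x x.2, h12 y y.2, h21 x x.2, h22 y y.2, projBilin_apply, generatorTensor]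

theorem IsKernelCompletion.ext_of_cross {K L : X → X → ℝ} (hcover : X₁ ∪ X₂ = Set.univ)
    (hX₁ : X₁ ×ˢ X₁ ⊆ Ω) (hX₂ : X₂ ×ˢ X₂ ⊆ Ω)
    (hK : IsKernelCompletion KΩ K) (hL : IsKernelCompletion KΩ L)
    (h : ∀ x ∈ X₁, ∀ y ∈ X₂, K x y = L x y) : K = L := by
  ext u v
  have hu : u ∈ X₁ ∪ X₂ := hcover ▸ Set.mem_univ u
  have hv : v ∈ X₁ ∪ X₂ := hcover ▸ Set.mem_univ v
  rcases hu with hu | hu <;> rcases hv with hv | hv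
  · exact (hK.2 ⟨(u, v), hX₁ ⟨hu, hv⟩⟩).trans (hL.2 ⟨(u, v), hX₁ ⟨hu, hv⟩⟩).symm
  · exact h u hu v hv
  · rw [hK.1.1, hL.1.1, h v hv u hu]
  · exact (hK.2 ⟨(u, v), hX₂ ⟨hu, hv⟩⟩).trans (hL.2 ⟨(u, v), hX₂ ⟨hu, hv⟩⟩).symm

/-! ### Existence criteria for contractive functionals -/

/-- By the Hahn–Banach theorem, contractive extensions exist as soon as `Φ₀` is a contraction. -/
theorem exists_isContractiveExtension_iff :
    (∃ Φ, IsContractiveExtension hK₁ hK₂ Φ) ↔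
      ∃ Φ₀ : deltaSpan hK₁ hK₂ →L[ℝ] ℝ, IsDeltaFunctional hK₁ hK₂ Φ₀ ∧ ‖Φ₀‖ ≤ 1 := by
  constructor
  · rintro ⟨Φ, hΦ, Φ₀, hΦ₀, h⟩
    refine ⟨Φ₀, hΦ₀, Φ₀.opNorm_le_bound zero_le_one fun τ => ?_⟩
    rw [← h]
    exact Φ.le_of_opNorm_le hΦ τ
  · rintro ⟨Φ₀, hΦ₀, hle⟩
    obtain ⟨Φ, h, hnorm⟩ := exists_extension_norm_eq (deltaSpan hK₁ hK₂) Φ₀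
    exact ⟨Φ, hnorm.trans_le hle, Φ₀, hΦ₀, h⟩

/-- The embedding into the completion preserves norms, so the algebraic projective norm can be used
for finite sums. -/
theorem norm_sum_smul_generatorTensor {n : ℕ} (x : Fin n → X₁) (y : Fin n → X₂)
    (a : Fin n → ℝ) :
    ‖∑ j, a j • generatorTensor hK₁ hK₂ (x j) (y j)‖ =
      projNorm (∑ j, a j •
        (KernelSpace.generator hK₁ (x j) ⊗ₜ[ℝ] KernelSpace.generator hK₂ (y j))) := by
  have := UniformSpace.Completion.norm_coe (E := ProjTensor (KernelSpace hK₁) (KernelSpace hK₂))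
    (∑ j, a j • ProjTensor.tmul (KernelSpace.generator hK₁ (x j))
      (KernelSpace.generator hK₂ (y j)))
  rw [← UniformSpace.Completion.coe_toComplL (𝕜 := ℝ)] at this
  simp only [map_sum, map_smul] at this
  exact this

theorem linearCombination_eq_sum_fin {ι M : Type*} [AddCommGroup M] [Module ℝ M] (w : ι → M)
    (c : ι →₀ ℝ) :
    Finsupp.linearCombination ℝ w c = ∑ i : Fin c.support.card,
      c (c.support.equivFin.symm i) • w (c.support.equivFin.symm i) := by
  rw [Finsupp.linearCombination_apply, Finsupp.sum, ← Finset.sum_coe_sort]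
  exact (Equiv.sum_comp c.support.equivFin.symm fun i => c (i : ι) • w i).symm

theorem exists_isDeltaFunctional_iff :
    (∃ Φ₀ : deltaSpan hK₁ hK₂ →L[ℝ] ℝ, IsDeltaFunctional hK₁ hK₂ Φ₀ ∧ ‖Φ₀‖ ≤ 1) ↔
      ∀ (n : ℕ), 1 ≤ n → ∀ (x : Fin n → X₁) (y : Fin n → X₂)
        (h : ∀ j, ((x j : X), (y j : X)) ∈ Ω) (a : Fin n → ℝ),
        |∑ j, a j * KΩ ⟨((x j : X), (y j : X)), h j⟩| ≤
          projNorm (∑ j, a j •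
            (KernelSpace.generator hK₁ (x j) ⊗ₜ[ℝ] KernelSpace.generator hK₂ (y j))) := by
  constructor
  · rintro ⟨Φ₀, hΦ₀, hle⟩ n - x y h a
    have := Φ₀.le_of_opNorm_le hle (∑ j, a j •
      ⟨generatorTensor hK₁ hK₂ (x j) (y j), generatorTensor_mem_deltaSpan hK₁ hK₂ (h j)⟩)
    rw [map_sum] at this
    simp only [map_smul, hΦ₀ _ _ (h _), one_mul, Submodule.coe_norm, Submodule.coe_sum,
      Submodule.coe_smul, norm_sum_smul_generatorTensor, Real.norm_eq_abs, smul_eq_mul] at this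
    exact this
  · intro h
    let ι := {p : X₁ × X₂ // ((p.1 : X), (p.2 : X)) ∈ Ω}
    let v : ι → deltaSpan hK₁ hK₂ := fun p =>
      ⟨generatorTensor hK₁ hK₂ p.1.1 p.1.2, generatorTensor_mem_deltaSpan hK₁ hK₂ p.2⟩
    let u : ι → ℝ := fun p => KΩ ⟨((p.1.1 : X), (p.1.2 : X)), p.2⟩
    -- The generator tensors span `deltaSpan` as vectors of that subspace, seen by pushing forward
    -- along its injective inclusion.
    have hspan : Submodule.span ℝ (Set.range v) = ⊤ := by
      have hset : {τ | ∃ (x : X₁) (y : X₂), ((x : X), (y : X)) ∈ Ω ∧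
          generatorTensor hK₁ hK₂ x y = τ} = Set.range fun p => (v p : ProjTensorSpace _ _) := by
        ext τ
        constructor
        · rintro ⟨x, y, hxy, rfl⟩
          exact ⟨⟨(x, y), hxy⟩, rfl⟩
        · rintro ⟨p, rfl⟩
          exact ⟨p.1.1, p.1.2, p.2, rfl⟩
      refine Submodule.map_injective_of_injective
        (deltaSpan hK₁ hK₂).injective_subtype ?_
      rw [Submodule.map_span, Submodule.map_subtype_top, ← Set.range_comp]
      exact congrArg (Submodule.span ℝ) hset.symm
    obtain ⟨Φ₀, hle, hΦ₀⟩ := exists_contraction_of_linearCombination_norm_le v u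
      (by rw [hspan]; exact eq_top_iff.2 (Submodule.le_topologicalClosure _)) fun c => by
        -- The inequality is assumed only for `n ≥ 1`, so the empty combination is treated apart.
        rcases c.support.eq_empty_or_nonempty with hc | hc
        · simp [Finsupp.support_eq_empty.mp hc]
        let p : Fin c.support.card → ι := fun i => c.support.equivFin.symm i
        have := h c.support.card hc.card_pos (fun i => (p i).1.1) (fun i => (p i).1.2)
          (fun i => (p i).2) (fun i => c (p i))
        rw [← norm_sum_smul_generatorTensor] at this
        rw [linearCombination_eq_sum_fin, linearCombination_eq_sum_fin, Submodule.coe_norm,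
          Submodule.coe_sum]
        exact this
    exact ⟨Φ₀, fun x y hxy => hΦ₀ ⟨(x, y), hxy⟩, hle⟩

end TwoSquares

/-! ### The equivalences and the bijection -/

theorem mainTheorem4 {X : Type*} {Ω : Set (X × X)} (hΩ : IsKernelDomain Ω) (KΩ : Ω → ℝ)
    (hsymm : ∀ (x y : X) (h : (x, y) ∈ Ω), KΩ ⟨(x, y), h⟩ = KΩ ⟨(y, x), hΩ.symm h⟩)
    (X₁ X₂ : Set X) (hcover : X₁ ∪ X₂ = Set.univ) (hdisj : Disjoint X₁ X₂)
    (hX₁ : X₁ ×ˢ X₁ ⊆ Ω) (hX₂ : X₂ ×ˢ X₂ ⊆ Ω)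
    (hK₁ : IsReproducingKernel (squareRestrict KΩ hX₁))
    (hK₂ : IsReproducingKernel (squareRestrict KΩ hX₂)) :
    ((∃ K, IsKernelCompletion KΩ K) ↔
      ∃ Φ₀ : deltaSpan hK₁ hK₂ →L[ℝ] ℝ, IsDeltaFunctional hK₁ hK₂ Φ₀ ∧ ‖Φ₀‖ ≤ 1) ∧
    ((∃ Φ₀ : deltaSpan hK₁ hK₂ →L[ℝ] ℝ, IsDeltaFunctional hK₁ hK₂ Φ₀ ∧ ‖Φ₀‖ ≤ 1) ↔
      ∀ (n : ℕ), 1 ≤ n → ∀ (x : Fin n → X₁) (y : Fin n → X₂)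
        (h : ∀ j, ((x j : X), (y j : X)) ∈ Ω) (a : Fin n → ℝ),
        |∑ j, a j * KΩ ⟨((x j : X), (y j : X)), h j⟩| ≤
          projNorm (∑ j, a j •
            (KernelSpace.generator hK₁ (x j) ⊗ₜ[ℝ] KernelSpace.generator hK₂ (y j)))) ∧
    ∃ e : {K : X → X → ℝ // IsKernelCompletion KΩ K} ≃
        {Φ : ProjTensorSpace (KernelSpace hK₁) (KernelSpace hK₂) →L[ℝ] ℝ //
          IsContractiveExtension hK₁ hK₂ Φ},
      ∀ K Φ, e K = Φ ↔
        ∀ (x : X₁) (y : X₂), Φ.1 (generatorTensor hK₁ hK₂ x y) = K.1 x y := by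
  refine ⟨?_, exists_isDeltaFunctional_iff hK₁ hK₂, ?_⟩
  · rw [← exists_isContractiveExtension_iff]
    constructor
    · rintro ⟨K, hK⟩
      obtain ⟨Φ, hΦ, -⟩ := hK.exists_isContractiveExtension hK₁ hK₂
      exact ⟨Φ, hΦ⟩
    · rintro ⟨Φ, hΦ⟩
      obtain ⟨K, hK, -⟩ := hΦ.exists_isKernelCompletion hK₁ hK₂ hΩ hsymm hcover hdisj
      exact ⟨K, hK⟩
  · choose G hG hGK using fun K : {K : X → X → ℝ // IsKernelCompletion KΩ K} =>
      K.2.exists_isContractiveExtension hK₁ hK₂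
    -- Injectivity holds because cross values determine a completion, surjectivity because values on
    -- generator tensors determine a functional; the latter also makes the choice of `G` immaterial.
    have hbij : Function.Bijective
        fun K => (⟨G K, hG K⟩ : {Φ // IsContractiveExtension hK₁ hK₂ Φ}) := by
      constructor
      · intro K L hKL
        have hGKL : G K = G L := congrArg Subtype.val hKL
        refine Subtype.ext (K.2.ext_of_cross hcover hX₁ hX₂ L.2 fun x hx y hy => ?_)
        exact (hGK K ⟨x, hx⟩ ⟨y, hy⟩).symm.trans (hGKL ▸ hGK L ⟨x, hx⟩ ⟨y, hy⟩)
      · rintro ⟨Φ, hΦ⟩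
        obtain ⟨K, hK, h⟩ := hΦ.exists_isKernelCompletion hK₁ hK₂ hΩ hsymm hcover hdisj
        exact ⟨⟨K, hK⟩, Subtype.ext <| projTensorSpace_functional_ext hK₁ hK₂ fun x y =>
          (hGK ⟨K, hK⟩ x y).trans (h x y).symm⟩
    refine ⟨Equiv.ofBijective _ hbij, fun K Φ => ⟨?_, fun h => ?_⟩⟩
    · rintro rfl
      exact hGK K
    · exact Subtype.ext <| projTensorSpace_functional_ext hK₁ hK₂ fun x y =>
        (hGK K x y).trans (h x y).symm
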